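/- **Theorem.** The categories $\mathbf{SkeLC}$ and $\mathbf{ESkeLC}$ defined below are (covariantly) equivalent. $\mathbf{SkeLC}$ is the category of all locally compact Hausdorff spaces and all continuous skeletal maps between them, with the usual composition. A map $f:X\to Y$ of topological spaces is *skeletal* if $\operatorname{int}(f^{-1}(\operatorname{cl}V))\subseteq\operatorname{cl}(f^{-1}(V))$ for every open $V\subseteq Y$. A *complete local contact algebra* is a triple $(B,\rho,\mathbb B)$, where $B$ is a complete Boolean algebra ($0=1$ is allowed) with complement denoted by ${}^*$, $\mathbb B$ is a (possibly improper) ideal of $B$, and $\rho$ is a binary relation on $B$ such that, writing $a\ll b$ for "not $a\,\rho\,b^*$": * $a\neq 0$ implies $a\rho a$; $a\rho b$ implies $a\ne0$ and $b\neq 0$; $a\rho b$ implies $b\rho a$; and $a\rho(b\vee c)$ iff $a\rho b$ or $a\rho c$; * if $a\in\mathbb B$, $c\in B$ and $a\ll c$, then $a\ll b\ll c$ for some $b\in\mathbb B$; * if $a\rho b$, then $a\rho(c\wedge b)$ for some $c\in\mathbb B$; * if $a\neq 0$, then there is $b\in\mathbb B\setminus\{0\}$ with $b\ll a$. $\mathbf{ESkeLC}$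 is the category whose objects are all complete local contact algebras and whose morphisms $(A,\rho,\mathbb B)\to(B,\eta,\mathbb B')$ are all functions $\psi:A\to B$, composed as functions, such that * (EF1) for every $a\in A$, $\psi(a)=0$ iff $a=0$; * (EF2) $\psi$ preserves all joins; * (EF3) if $a\in A$, $b\in B$ and $b\le\psi(a)$, then there is $c\in A$ with $c\le a$ and $\psi(c)=b$; * (EL4) for all $a,b\in A$, $a\rho b$ implies $\psi(a)\,\eta\,\psi(b)$; * (EL5) if $a\in\mathbb B$, then $\psi(a)\in\mathbb B'$. -/

import Mathlib

open CategoryTheory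

universe u

/-- A map `f` is skeletal if `int (f⁻¹ (cl V)) ⊆ cl (f⁻¹ V)` for every open `V`. -/
def IsSkeletal {X Y : Type*} [TopologicalSpace X] [TopologicalSpace Y] (f : X → Y) : Prop :=
  ∀ V : Set Y, IsOpen V → interior (f ⁻¹' closure V) ⊆ closure (f ⁻¹' V)

theorem IsSkeletal.id (X : Type*) [TopologicalSpace X] : IsSkeletal (fun x : X => x) := by
  intro V _
  exact interior_subset

theorem IsSkeletal.comp {X Y Z : Type*} [TopologicalSpace X] [TopologicalSpace Y]
    [TopologicalSpace Z] {g : Y → Z} {f : X → Y} (hg : IsSkeletal g) (hgc : Continuous g)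
    (hf : IsSkeletal f) : IsSkeletal (g ∘ f) := by
  intro V hV x hx
  by_contra hxc
  set K : Set Y := g ⁻¹' closure V \ g ⁻¹' V with hK
  have hKclosed : IsClosed K :=
    (isClosed_closure.preimage hgc).sdiff (hV.preimage hgc)
  have hKint : interior K = ∅ := by
    by_contra hne
    obtain ⟨y, hy⟩ := Set.nonempty_iff_ne_empty.mpr hne
    have h1 : y ∈ closure (g ⁻¹' V) :=
      hg V hV (interior_mono Set.sdiff_subset hy)
    obtain ⟨z, hz1, hz2⟩ := mem_closure_iff.mp h1 _ isOpen_interior hy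
    exact (interior_subset hz1).2 hz2
  have hdense : closure Kᶜ = Set.univ := by
    rw [closure_compl, hKint, Set.compl_empty]
  have hx' : x ∈ closure (f ⁻¹' Kᶜ) := by
    apply hf Kᶜ hKclosed.isOpen_compl
    rw [hdense, Set.preimage_univ, interior_univ]
    trivial
  obtain ⟨z, ⟨hz1, hz2⟩, hz3⟩ := mem_closure_iff.mp hx'
    (interior ((g ∘ f) ⁻¹' closure V) ∩ (closure ((g ∘ f) ⁻¹' V))ᶜ)
    (isOpen_interior.inter isClosed_closure.isOpen_compl) ⟨hx, hxc⟩
  have hz4 : z ∈ (g ∘ f) ⁻¹' closure V := interior_subset hz1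
  exact hz3 ⟨hz4, fun h => hz2 (subset_closure h)⟩

/-- Objects of the category `SkeLC`: locally compact Hausdorff spaces. -/
structure SkeLC : Type (u + 1) where
  carrier : Type u
  [top : TopologicalSpace carrier]
  [t2 : T2Space carrier]
  [lc : LocallyCompactSpace carrier]

attribute [instance] SkeLC.top SkeLC.t2 SkeLC.lc

/-- Morphisms of `SkeLC`: continuous skeletal maps. -/
@[ext]
structure SkeLC.Hom (X Y : SkeLC.{u}) : Type u where
  toFun : X.carrier → Y.carrier
  continuous_toFun : Continuous toFun
  skeletal_toFun : IsSkeletal toFun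

instance SkeLC.category : Category.{u} SkeLC.{u} where
  Hom X Y := SkeLC.Hom X Y
  id X := ⟨fun x => x, continuous_id, IsSkeletal.id _⟩
  comp f g := ⟨g.toFun ∘ f.toFun, g.continuous_toFun.comp f.continuous_toFun,
    g.skeletal_toFun.comp g.continuous_toFun f.skeletal_toFun⟩

/-- `C` is a contact relation on the Boolean algebra `B` (which may be trivial). -/
structure IsContactRelation {B : Type*} [BooleanAlgebra B] (C : B → B → Prop) : Prop where
  refl_of_ne_bot : ∀ a, a ≠ ⊥ → C a a
  ne_bot : ∀ a b, C a b → a ≠ ⊥ ∧ b ≠ ⊥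
  symm : ∀ a b, C a b → C b a
  sup_iff : ∀ a b c, C a (b ⊔ c) ↔ C a b ∨ C a c

/-- Non-tangential inclusion `a ≪ b`, i.e. `a` is not in contact with the complement of `b`. -/
def NonTangential {B : Type*} [BooleanAlgebra B] (C : B → B → Prop) (a b : B) : Prop :=
  ¬ C a bᶜ

/-- `(B, ρ, I)` is a local contact algebra; the elements of the (possibly improper) ideal `I`
are the bounded elements. -/
structure IsLocalContactAlgebra {B : Type*} [BooleanAlgebra B] (ρ : B → B → Prop)
    (I : Order.Ideal B) : Prop where
  contact : IsContactRelation ρ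
  interpolate : ∀ a ∈ I, ∀ c, NonTangential ρ a c →
    ∃ b ∈ I, NonTangential ρ a b ∧ NonTangential ρ b c
  contact_bounded : ∀ a b, ρ a b → ∃ c ∈ I, ρ a (c ⊓ b)
  exists_bounded : ∀ a, a ≠ ⊥ → ∃ b ∈ I, b ≠ ⊥ ∧ NonTangential ρ b a

/-- Objects of the category `ESkeLC`: complete local contact algebras. -/
structure ESkeLC : Type (u + 1) where
  carrier : Type u
  [cba : CompleteBooleanAlgebra carrier]
  contact : carrier → carrier → Prop
  bounded : Order.Ideal carrier
  isLCA : IsLocalContactAlgebra contact bounded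

attribute [instance] ESkeLC.cba

/-- Morphisms of `ESkeLC`. -/
@[ext]
structure ESkeLC.Hom (A B : ESkeLC.{u}) : Type u where
  toFun : A.carrier → B.carrier
  eq_bot_iff : ∀ a, toFun a = ⊥ ↔ a = ⊥
  map_sSup : ∀ S : Set A.carrier, toFun (sSup S) = sSup (toFun '' S)
  lift_le : ∀ a b, b ≤ toFun a → ∃ c, c ≤ a ∧ toFun c = b
  map_contact : ∀ a b, A.contact a b → B.contact (toFun a) (toFun b)
  map_bounded : ∀ a, a ∈ A.bounded → toFun a ∈ B.bounded

instance ESkeLC.category : Category.{u} ESkeLC.{u} where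
  Hom A B := ESkeLC.Hom A B
  id A :=
    { toFun := fun a => a
      eq_bot_iff := fun _ => Iff.rfl
      map_sSup := fun S => by rw [Set.image_id']
      lift_le := fun _ b h => ⟨b, h, rfl⟩
      map_contact := fun _ _ h => h
      map_bounded := fun _ h => h }
  comp f g :=
    { toFun := g.toFun ∘ f.toFun
      eq_bot_iff := fun a => (g.eq_bot_iff _).trans (f.eq_bot_iff a)
      map_sSup := fun S => by
        rw [Function.comp_apply, f.map_sSup, g.map_sSup, Set.image_comp]
      lift_le := fun a b h => by
        obtain ⟨c, hc, rfl⟩ := g.lift_le _ b h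
        obtain ⟨d, hd, rfl⟩ := f.lift_le a c hc
        exact ⟨d, hd, rfl⟩
      map_contact := fun _ _ h => g.map_contact _ _ (f.map_contact _ _ h)
      map_bounded := fun _ h => g.map_bounded _ (f.map_bounded _ h) }

open Set Topology

/-! The equivalence sends a space `X` to the algebra of its regular closed sets, where contact means
intersecting and bounded means compact, and sends `f` to `F ↦ closure (f '' F)`. Skeletality is what
makes `closure (f '' F)` regular closed.

The functor is full because a morphism `ψ` determines a point map: `x` must go into `ψ F` for every
compact regular closed neighbourhood `F` of `x`. Compactness makes the intersection `fiber ψ x` of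
these sets nonempty. It is a single point: by `lift_le`, `x` lies in the largest `F` with `ψ F ≤ G`,
for each regular closed neighbourhood `G` of a point of the fibre, so preservation of contact
forbids two disjoint such `G` (`mem_rightAdjoint`, `fiber_subsingleton`). The map so obtained
induces `ψ` (`closure_image_toMap`).

The functor is essentially surjective because an algebra is recovered from its space of round prime
filters, with `a` represented by `basicClosed a`. Prime ideals supply enough points to detect
contact (`contact_iff`), compactness detects boundedness (`isCompact_basicClosed_iff`), and
completeness makes every regular closed set arise (`toRegClosed_surjective`). -/

/-! ### The local contact algebra of regular closed sets. -/

/-- Regular closed subsets of a topological space. -/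
@[ext]
structure RegClosed (X : Type*) [TopologicalSpace X] where
  carrier : Set X
  closure_interior : closure (interior carrier) = carrier

namespace RegClosed

variable {X Y : Type*} [TopologicalSpace X] [TopologicalSpace Y]

theorem isClosed (F : RegClosed X) : IsClosed F.carrier :=
  F.closure_interior ▸ isClosed_closure

theorem closure_interior_closure {U : Set X} (hU : IsOpen U) :
    closure (interior (closure U)) = closure U :=
  (closure_minimal interior_subset isClosed_closure).antisymm
    (closure_mono (interior_maximal subset_closure hU))

/-- The regular closed set obtained as the closure of an open set. -/
def ofOpen (U : Set X) (hU : IsOpen U) : RegClosed X :=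
  ⟨closure U, closure_interior_closure hU⟩

theorem subset_iff (F : RegClosed X) {C : Set X} (hC : IsClosed C) :
    F.carrier ⊆ C ↔ interior F.carrier ⊆ C :=
  ⟨interior_subset.trans, fun h => F.closure_interior ▸ closure_minimal h hC⟩

theorem nonempty_inter_interior (F : RegClosed X) {U : Set X} (hU : IsOpen U) {x : X}
    (hx : x ∈ F.carrier) (hxU : x ∈ U) : (interior F.carrier ∩ U).Nonempty := by
  rw [← F.closure_interior] at hx
  rw [inter_comm]
  exact mem_closure_iff.mp hx U hU hxU

instance : PartialOrder (RegClosed X) :=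
  PartialOrder.lift RegClosed.carrier fun _ _ => RegClosed.ext

theorem le_def {F G : RegClosed X} : F ≤ G ↔ F.carrier ⊆ G.carrier := Iff.rfl

instance : CompleteLattice (RegClosed X) where
  sup F G := ⟨F.carrier ∪ G.carrier, by
    refine (closure_minimal interior_subset (F.isClosed.union G.isClosed)).antisymm
      (union_subset ?_ ?_)
    · conv_lhs => rw [← F.closure_interior]
      exact closure_mono (interior_mono subset_union_left)
    · conv_lhs => rw [← G.closure_interior]
      exact closure_mono (interior_mono subset_union_right)⟩
  le_sup_left _ _ := subset_union_left
  le_sup_right _ _ := subset_union_right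
  sup_le _ _ _ := union_subset
  inf F G := ofOpen (interior (F.carrier ∩ G.carrier)) isOpen_interior
  inf_le_left F G :=
    closure_minimal (interior_subset.trans inter_subset_left) F.isClosed
  inf_le_right F G :=
    closure_minimal (interior_subset.trans inter_subset_right) G.isClosed
  le_inf F G H hG hH := (F.subset_iff isClosed_closure).2
    ((interior_mono (subset_inter hG hH)).trans subset_closure)
  sSup S := ofOpen (⋃ F ∈ S, interior F.carrier)
    (isOpen_biUnion fun _ _ => isOpen_interior)
  isLUB_sSup S :=
    ⟨fun F hF => (F.subset_iff isClosed_closure).2 fun _ hx =>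
      subset_closure (mem_biUnion hF hx),
    fun G hG => closure_minimal
      (iUnion₂_subset fun _ hF => interior_subset.trans (hG hF)) G.isClosed⟩
  sInf S := ofOpen (interior (⋂ F ∈ S, F.carrier)) isOpen_interior
  isGLB_sInf S :=
    ⟨fun F hF => closure_minimal 
      (interior_subset.trans fun _ hx => mem_iInter₂.1 hx F hF) F.isClosed,
    fun G hG => (G.subset_iff isClosed_closure).2
      ((interior_mono fun _ hx => mem_iInter₂.2 fun _ hF => le_def.1 (hG hF) hx).trans
        subset_closure)⟩
  top := ⟨univ, by simp⟩
  bot := ⟨∅, by simp⟩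
  le_top _ := subset_univ _
  bot_le _ := empty_subset _

theorem sup_carrier (F G : RegClosed X) : (F ⊔ G).carrier = F.carrier ∪ G.carrier := rfl

theorem inf_carrier (F G : RegClosed X) :
    (F ⊓ G).carrier = closure (interior F.carrier ∩ interior G.carrier) := by
  rw [← interior_inter]; rfl

theorem bot_carrier : (⊥ : RegClosed X).carrier = ∅ := rfl

theorem sSup_carrier (S : Set (RegClosed X)) :
    (sSup S).carrier = closure (⋃ F ∈ S, interior F.carrier) := rfl

theorem ne_bot_iff {F : RegClosed X} : F ≠ ⊥ ↔ F.carrier.Nonempty := by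
  rw [nonempty_iff_ne_empty, ← bot_carrier, Ne, Ne, RegClosed.ext_iff]

instance : CompleteBooleanAlgebra (RegClosed X) where
  le_sup_inf F G H := by
    refine closure_minimal ?_ (F ⊔ G ⊓ H).isClosed
    intro x hx
    by_cases hF : x ∈ F.carrier
    · exact Or.inl hF
    -- Outside the closed set `F` both joins reduce to `G` and `H`, so removing `F` from the open
    -- set leaves an open neighbourhood of `x` inside `G ∩ H`.
    · refine Or.inr (subset_closure (mem_interior.2
        ⟨interior ((F ⊔ G).carrier ∩ (F ⊔ H).carrier) ∩ F.carrierᶜ, ?_,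
          isOpen_interior.inter F.isClosed.isOpen_compl, hx, hF⟩))
      rintro y ⟨hy, hyF⟩
      obtain ⟨h1, h2⟩ := interior_subset hy
      exact ⟨h1.resolve_left hyF, h2.resolve_left hyF⟩
  compl F := ofOpen F.carrierᶜ F.isClosed.isOpen_compl
  inf_compl_le_bot F := by
    refine closure_minimal ?_ isClosed_empty
    intro x hx
    obtain ⟨y, hy1, hy2⟩ := mem_closure_iff.1 (interior_subset hx).2 _ isOpen_interior hx
    exact hy2 (interior_subset hy1).1
  top_le_sup_compl F x _ := by
    by_cases hF : x ∈ F.carrier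
    · exact Or.inl hF
    · exact Or.inr (subset_closure hF)
  le_top _ := subset_univ _
  bot_le _ := empty_subset _

theorem compl_carrier (F : RegClosed X) : Fᶜ.carrier = (interior F.carrier)ᶜ :=
  closure_compl

/-- Two regular closed sets are in contact when they intersect. -/
def Contact (F G : RegClosed X) : Prop := (F.carrier ∩ G.carrier).Nonempty

theorem nonTangential_iff {F G : RegClosed X} :
    NonTangential Contact F G ↔ F.carrier ⊆ interior G.carrier := by
  rw [NonTangential, Contact, compl_carrier, inter_compl_nonempty_iff, not_not]

variable (X) in
/-- The ideal of compact regular closed sets. -/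
def compacts : Order.Ideal (RegClosed X) where
  carrier := {F | IsCompact F.carrier}
  lower' _ G hGF hF := hF.of_isClosed_subset G.isClosed hGF
  nonempty' := ⟨⊥, isCompact_empty⟩
  directed' _ hF _ hG := ⟨_, hF.union hG, le_sup_left, le_sup_right⟩

theorem exists_compact_between_of_subset [T2Space X] [LocallyCompactSpace X] {K U : Set X}
    (hK : IsCompact K) (hU : IsOpen U) (hKU : K ⊆ U) :
    ∃ F : RegClosed X, IsCompact F.carrier ∧ K ⊆ interior F.carrier ∧ F.carrier ⊆ U := by
  obtain ⟨L, hL, hKL, hLU⟩ := exists_compact_between hK hU hKU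
  have h : closure (interior L) ⊆ L := closure_minimal interior_subset hL.isClosed
  exact ⟨ofOpen _ isOpen_interior, hL.of_isClosed_subset isClosed_closure h,
    hKL.trans (interior_maximal subset_closure isOpen_interior), h.trans hLU⟩

theorem exists_compact_nhd [T2Space X] [LocallyCompactSpace X] {x : X} {U : Set X}
    (hU : IsOpen U) (hx : x ∈ U) :
    ∃ F : RegClosed X, IsCompact F.carrier ∧ x ∈ interior F.carrier ∧ F.carrier ⊆ U := by
  obtain ⟨F, h1, h2, h3⟩ :=
    exists_compact_between_of_subset isCompact_singleton hU (singleton_subset_iff.2 hx)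
  exact ⟨F, h1, singleton_subset_iff.1 h2, h3⟩

theorem isLocalContactAlgebra [T2Space X] [LocallyCompactSpace X] :
    IsLocalContactAlgebra (Contact (X := X)) (compacts X) where
  contact :=
    { refl_of_ne_bot := fun F hF => by rwa [Contact, inter_self, ← ne_bot_iff]
      ne_bot := fun F G h => ⟨ne_bot_iff.2 h.left, ne_bot_iff.2 h.right⟩
      symm := fun F G h => by rwa [Contact, inter_comm]
      sup_iff := fun F G H => by
        rw [Contact, sup_carrier, inter_union_distrib_left, union_nonempty]; rfl }
  interpolate F hF G hFG := by
    obtain ⟨H, h1, h2, h3⟩ := exists_compact_between_of_subset hF isOpen_interior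
      (nonTangential_iff.1 hFG)
    exact ⟨H, h1, nonTangential_iff.2 h2, nonTangential_iff.2 h3⟩
  contact_bounded F G := by
    rintro ⟨x, hF, hG⟩
    obtain ⟨H, h1, h2, -⟩ := exists_compact_nhd isOpen_univ (mem_univ x)
    refine ⟨H, h1, x, hF, ?_⟩
    rw [inf_carrier]
    refine isOpen_interior.inter_closure ⟨h2, ?_⟩
    rwa [G.closure_interior]
  exists_bounded F hF := by
    obtain ⟨x, hx⟩ := ne_bot_iff.1 hF
    obtain ⟨y, hy, -⟩ := F.nonempty_inter_interior isOpen_univ hx (mem_univ x)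
    obtain ⟨H, h1, h2, h3⟩ := exists_compact_nhd isOpen_interior hy
    exact ⟨H, h1, ne_bot_iff.2 ⟨y, interior_subset h2⟩, nonTangential_iff.2 h3⟩

end RegClosed

/-! ### Direct images under skeletal maps and the functor. -/

namespace IsSkeletal

variable {X Y : Type*} [TopologicalSpace X] [TopologicalSpace Y] {f : X → Y}

theorem closure_image_interior (hf : Continuous f) (F : RegClosed X) :
    closure (f '' interior F.carrier) = closure (f '' F.carrier) := by
  conv_rhs => rw [← F.closure_interior]
  exact (closure_mono (image_mono subset_closure)).antisymm
    (closure_minimal (image_closure_subset_closure_image hf) isClosed_closure)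

/-- If some `x` in the interior of `F` had `f x` outside `closure (interior G)`, a neighbourhood of
`x` inside `F` would map into `closure Gᶜ`. Skeletality for the open set `Gᶜ` then gives a point of
`F` mapped outside `G`, which is absurd. -/
theorem closure_interior_closure_image (hf : IsSkeletal f) (hc : Continuous f)
    (F : RegClosed X) :
    closure (interior (closure (f '' F.carrier))) = closure (f '' F.carrier) := by
  set G := closure (f '' F.carrier) with hG
  have hGc : IsClosed G := isClosed_closure
  refine (closure_minimal interior_subset hGc).antisymm ?_
  conv_lhs => rw [hG, ← closure_image_interior hc]
  refine closure_minimal ?_ isClosed_closure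
  rintro _ ⟨x, hx, rfl⟩
  by_contra hxV
  have hWo : IsOpen (interior F.carrier ∩ f ⁻¹' (closure (interior G))ᶜ) :=
    isOpen_interior.inter (isClosed_closure.isOpen_compl.preimage hc)
  have hx' : x ∈ interior (f ⁻¹' closure Gᶜ) := by
    refine mem_interior.2 ⟨_, ?_, hWo, hx, hxV⟩
    rintro y ⟨-, hy⟩
    rw [mem_preimage, closure_compl]
    exact fun h => hy (subset_closure h)
  obtain ⟨z, ⟨hz1, -⟩, hz2⟩ := mem_closure_iff.1 (hf _ hGc.isOpen_compl hx') _ hWo ⟨hx, hxV⟩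
  exact hz2 (subset_closure (mem_image_of_mem f (interior_subset hz1)))

end IsSkeletal

namespace SkeLC

/-- The complete local contact algebra of regular closed subsets. -/
def regClosed (X : SkeLC.{u}) : ESkeLC.{u} where
  carrier := RegClosed X.carrier
  contact := RegClosed.Contact
  bounded := RegClosed.compacts X.carrier
  isLCA := RegClosed.isLocalContactAlgebra

variable {X Y : SkeLC.{u}}

/-- The regular closed set `closure (f '' F)`. -/
def Hom.image (f : SkeLC.Hom X Y) (F : RegClosed X.carrier) : RegClosed Y.carrier :=
  ⟨closure (f.toFun '' F.carrier),
    f.skeletal_toFun.closure_interior_closure_image f.continuous_toFun F⟩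

theorem Hom.image_carrier (f : SkeLC.Hom X Y) (F : RegClosed X.carrier) :
    (f.image F).carrier = closure (f.toFun '' F.carrier) := rfl

theorem Hom.image_carrier_of_isCompact (f : SkeLC.Hom X Y) {F : RegClosed X.carrier}
    (hF : IsCompact F.carrier) : (f.image F).carrier = f.toFun '' F.carrier :=
  (hF.image f.continuous_toFun).isClosed.closure_eq

theorem Hom.image_le_iff (f : SkeLC.Hom X Y) {F : RegClosed X.carrier}
    {G : RegClosed Y.carrier} : f.image F ≤ G ↔ f.toFun '' F.carrier ⊆ G.carrier :=
  G.isClosed.closure_subset_iff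

theorem Hom.image_eq_bot_iff (f : SkeLC.Hom X Y) (F : RegClosed X.carrier) :
    f.image F = ⊥ ↔ F = ⊥ := by
  rw [← not_iff_not, ← Ne, ← Ne, RegClosed.ne_bot_iff, RegClosed.ne_bot_iff, image_carrier,
    closure_nonempty_iff, image_nonempty]

theorem Hom.image_sSup (f : SkeLC.Hom X Y) (S : Set (RegClosed X.carrier)) :
    f.image (sSup S) = sSup (f.image '' S) := by
  refine le_antisymm ?_ (sSup_le ?_)
  · rw [image_le_iff, RegClosed.sSup_carrier]
    refine (image_closure_subset_closure_image f.continuous_toFun).trans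
      (closure_minimal ?_ (sSup (f.image '' S)).isClosed)
    rintro _ ⟨x, hx, rfl⟩
    obtain ⟨F, hF, hxF⟩ := mem_iUnion₂.1 hx
    exact le_sSup (mem_image_of_mem f.image hF)
      (subset_closure (mem_image_of_mem _ (interior_subset hxF)))
  · rintro _ ⟨F, hF, rfl⟩
    exact closure_mono (image_mono (le_sSup hF : F ≤ sSup S))

theorem Hom.exists_image_eq (f : SkeLC.Hom X Y) {F : RegClosed X.carrier}
    {G : RegClosed Y.carrier} (h : G ≤ f.image F) : ∃ H ≤ F, f.image H = G := by
  -- The image of this open set is dense in `interior G`, because `f '' interior F` is already dense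
  -- in `closure (f '' F)`.
  refine ⟨RegClosed.ofOpen (interior F.carrier ∩ f.toFun ⁻¹' interior G.carrier)
    (isOpen_interior.inter (isOpen_interior.preimage f.continuous_toFun)),
    closure_minimal (inter_subset_left.trans interior_subset) F.isClosed, le_antisymm ?_ ?_⟩
  · rw [image_le_iff]
    refine (image_closure_subset_closure_image f.continuous_toFun).trans
      (closure_minimal ?_ G.isClosed)
    rintro _ ⟨x, ⟨-, hx⟩, rfl⟩
    exact interior_subset hx
  · refine (G.subset_iff (RegClosed.isClosed _)).2 fun y hy => ?_
    have hy' : y ∈ closure (f.toFun '' interior F.carrier) := by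
      rw [IsSkeletal.closure_image_interior f.continuous_toFun]
      exact h (interior_subset hy)
    refine closure_mono (image_mono subset_closure) (mem_closure_iff.2 fun U hU hyU => ?_)
    obtain ⟨_, ⟨h1, h2⟩, x, hx, rfl⟩ :=
      mem_closure_iff.1 hy' (U ∩ interior G.carrier) (hU.inter isOpen_interior) ⟨hyU, hy⟩
    exact ⟨f.toFun x, h1, x, ⟨hx, h2⟩, rfl⟩

/-- The morphism of complete local contact algebras induced by a continuous skeletal map. -/
def Hom.regClosedMap (f : SkeLC.Hom X Y) : ESkeLC.Hom X.regClosed Y.regClosed where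
  toFun := f.image
  eq_bot_iff := f.image_eq_bot_iff
  map_sSup := f.image_sSup
  lift_le _ _ := f.exists_image_eq
  map_contact := by
    rintro F G ⟨x, hF, hG⟩
    exact ⟨f.toFun x, subset_closure (mem_image_of_mem _ hF),
      subset_closure (mem_image_of_mem _ hG)⟩
  map_bounded F hF := by
    change IsCompact (f.image F).carrier
    rw [f.image_carrier_of_isCompact hF]
    exact hF.image f.continuous_toFun

/-- The functor sending a locally compact Hausdorff space to its regular closed subsets. -/
def regClosedFunctor : SkeLC.{u} ⥤ ESkeLC.{u} where
  obj := regClosed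
  map f := Hom.regClosedMap f
  map_id X := ESkeLC.Hom.ext <| funext fun F => RegClosed.ext <| by
    change closure ((fun x => x) '' F.carrier) = F.carrier
    rw [image_id', F.isClosed.closure_eq]
  map_comp f g := ESkeLC.Hom.ext <| funext fun F => RegClosed.ext <| by
    change closure ((g.toFun ∘ f.toFun) '' F.carrier) =
      closure (g.toFun '' closure (f.toFun '' F.carrier))
    rw [image_comp]
    exact (closure_mono (image_mono subset_closure)).antisymm
      (closure_minimal (image_closure_subset_closure_image g.continuous_toFun) isClosed_closure)

end SkeLC

/-! ### Faithfulness. -/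

namespace SkeLC

variable {X Y : SkeLC.{u}}

theorem Hom.image_injective : Function.Injective (Hom.image (X := X) (Y := Y)) := by
  intro f g h
  refine Hom.ext (funext fun x => ?_)
  by_contra hne
  obtain ⟨U, V, hU, hV, hxU, hxV, hUV⟩ := t2_separation hne
  -- A neighbourhood `F` of `x` with `g '' F ⊆ V` suffices: `f x` lies in `closure (f '' F) =
  -- closure (g '' F)`, so `U` would meet `V`.
  obtain ⟨F, -, hxF, hFV⟩ :=
    RegClosed.exists_compact_nhd (hV.preimage g.continuous_toFun) (show x ∈ _ from hxV)
  have h1 : f.toFun x ∈ (g.image F).carrier := by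
    rw [← h]
    exact subset_closure (mem_image_of_mem _ (interior_subset hxF))
  obtain ⟨_, h2, z, hz, rfl⟩ := mem_closure_iff.1 h1 U hU hxU
  exact hUV.ne_of_mem h2 (hFV hz) rfl

instance : regClosedFunctor.Faithful where
  map_injective h := Hom.image_injective (congrArg ESkeLC.Hom.toFun h)

end SkeLC

/-! ### Fullness: recovering the point map from a morphism. -/

/-- The data of a morphism between the algebras of regular closed sets, stated without reference
to the category of complete local contact algebras. -/
structure RegClosed.IsContactMap {X Y : Type*} [TopologicalSpace X] [TopologicalSpace Y]
    (ψ : RegClosed X → RegClosed Y) : Prop where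
  eq_bot_iff : ∀ F, ψ F = ⊥ ↔ F = ⊥
  map_sSup : ∀ S : Set (RegClosed X), ψ (sSup S) = sSup (ψ '' S)
  lift_le : ∀ F G, G ≤ ψ F → ∃ H, H ≤ F ∧ ψ H = G
  map_contact : ∀ F G, Contact F G → Contact (ψ F) (ψ G)
  map_compact : ∀ F : RegClosed X, IsCompact F.carrier → IsCompact (ψ F).carrier

namespace RegClosed.IsContactMap

variable {X Y : Type*} [TopologicalSpace X] [TopologicalSpace Y] {ψ : RegClosed X → RegClosed Y}

theorem monotone (hψ : IsContactMap ψ) : Monotone ψ := by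
  intro F G h
  have := hψ.map_sSup {F, G}
  rw [sSup_pair, sup_eq_right.2 h, image_pair, sSup_pair] at this
  exact this ▸ le_sup_left

/-- The largest regular closed set mapped below `G`. -/
def rightAdjoint (ψ : RegClosed X → RegClosed Y) (G : RegClosed Y) : RegClosed X :=
  sSup {F | ψ F ≤ G}

theorem map_rightAdjoint_le (hψ : IsContactMap ψ) (G : RegClosed Y) :
    ψ (rightAdjoint ψ G) ≤ G := by
  rw [rightAdjoint, hψ.map_sSup]
  exact sSup_le (by rintro _ ⟨F, hF, rfl⟩; exact hF)

/-- The intersection of the images of the compact regular closed neighbourhoods of a point. -/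
def fiber (ψ : RegClosed X → RegClosed Y) (x : X) : Set Y :=
  ⋂ F : {F : RegClosed X // IsCompact F.carrier ∧ x ∈ interior F.carrier}, (ψ F).carrier

theorem mem_fiber {x : X} {y : Y} : y ∈ fiber ψ x ↔
    ∀ F : RegClosed X, IsCompact F.carrier → x ∈ interior F.carrier → y ∈ (ψ F).carrier := by
  simp [fiber]

variable [T2Space X] [LocallyCompactSpace X]

theorem directed (hψ : IsContactMap ψ) (x : X) : Directed (· ⊇ ·)
    fun F : {F : RegClosed X // IsCompact F.carrier ∧ x ∈ interior F.carrier} =>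
      (ψ F).carrier := by
  rintro ⟨F, hF, hxF⟩ ⟨G, hG, hxG⟩
  obtain ⟨H, hH, hxH, hHFG⟩ := exists_compact_nhd (isOpen_interior.inter isOpen_interior)
    (⟨hxF, hxG⟩ : x ∈ interior F.carrier ∩ interior G.carrier)
  exact ⟨⟨H, hH, hxH⟩, hψ.monotone (hHFG.trans (inter_subset_left.trans interior_subset)),
    hψ.monotone (hHFG.trans (inter_subset_right.trans interior_subset))⟩

/-- A directed family of nonempty compact closed sets has a common point; `eq_bot_iff` keeps the
sets nonempty and `map_compact` keeps them compact. -/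
theorem fiber_nonempty (hψ : IsContactMap ψ) (x : X) : (fiber ψ x).Nonempty := by
  obtain ⟨F, hF, hxF, -⟩ := exists_compact_nhd isOpen_univ (mem_univ x)
  have : Nonempty {F : RegClosed X // IsCompact F.carrier ∧ x ∈ interior F.carrier} :=
    ⟨⟨F, hF, hxF⟩⟩
  refine IsCompact.nonempty_iInter_of_directed_nonempty_isCompact_isClosed _ (hψ.directed x)
    (fun F => ?_) (fun F => hψ.map_compact _ F.2.1) (fun F => (ψ F).isClosed)
  rw [← ne_bot_iff, Ne, hψ.eq_bot_iff, ← Ne, ne_bot_iff]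
  exact ⟨x, interior_subset F.2.2⟩

/-- The point map inducing a given contact map. -/
noncomputable def toMap (hψ : IsContactMap ψ) (x : X) : Y := (hψ.fiber_nonempty x).some

theorem toMap_mem (hψ : IsContactMap ψ) {x : X} {F : RegClosed X}
    (hx : x ∈ interior F.carrier) : hψ.toMap x ∈ (ψ F).carrier := by
  obtain ⟨H, hH, hxH, hHF⟩ := exists_compact_nhd isOpen_interior hx
  exact hψ.monotone (hHF.trans interior_subset)
    (mem_fiber.1 (hψ.fiber_nonempty x).some_mem H hH hxH)

/-- Otherwise a neighbourhood `C` of `x` misses the right adjoint. Since `ψ C ⊓ G` is nonzero,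
`lift_le` yields a nonzero `H ≤ C` with `ψ H ≤ G`, and such an `H` lies below the right adjoint. -/
theorem mem_rightAdjoint (hψ : IsContactMap ψ) {x : X} {y : Y} (hy : y ∈ fiber ψ x)
    {G : RegClosed Y} (hG : y ∈ interior G.carrier) : x ∈ (rightAdjoint ψ G).carrier := by
  by_contra hx
  obtain ⟨C, hC, hxC, hCG⟩ := exists_compact_nhd (isClosed _).isOpen_compl hx
  have hne : ψ C ⊓ G ≠ ⊥ := by
    rw [ne_bot_iff, inf_carrier, closure_nonempty_iff]
    exact nonempty_inter_interior _ isOpen_interior (mem_fiber.1 hy C hC hxC) hG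
  obtain ⟨H, hHC, hH⟩ := hψ.lift_le C (ψ C ⊓ G) inf_le_left
  rw [← hH, Ne, hψ.eq_bot_iff, ← Ne, ne_bot_iff] at hne
  obtain ⟨z, hz⟩ := hne
  have hHG : H ≤ rightAdjoint ψ G := le_sSup (hH.le.trans inf_le_right)
  exact hCG (hHC hz) (hHG hz)

variable [T2Space Y] [LocallyCompactSpace Y]

theorem fiber_subsingleton (hψ : IsContactMap ψ) (x : X) : (fiber ψ x).Subsingleton := by
  intro y hy z hz
  by_contra hne
  obtain ⟨U, V, hU, hV, hyU, hzV, hUV⟩ := t2_separation hne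
  obtain ⟨G, -, hyG, hGU⟩ := exists_compact_nhd hU hyU
  obtain ⟨H, -, hzH, hHV⟩ := exists_compact_nhd hV hzV
  obtain ⟨w, hw1, hw2⟩ := hψ.map_contact _ _
    ⟨x, hψ.mem_rightAdjoint hy hyG, hψ.mem_rightAdjoint hz hzH⟩
  exact hUV.ne_of_mem (hGU (hψ.map_rightAdjoint_le G hw1)) (hHV (hψ.map_rightAdjoint_le H hw2)) rfl

theorem fiber_eq (hψ : IsContactMap ψ) (x : X) : fiber ψ x = {hψ.toMap x} :=
  (hψ.fiber_subsingleton x).eq_singleton_of_mem (hψ.fiber_nonempty x).some_mem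

theorem continuous_toMap (hψ : IsContactMap ψ) : Continuous hψ.toMap := by
  refine continuous_iff_continuousAt.2 fun x U hU => ?_
  obtain ⟨F, hF, hxF, -⟩ := exists_compact_nhd isOpen_univ (mem_univ x)
  have : Nonempty {F : RegClosed X // IsCompact F.carrier ∧ x ∈ interior F.carrier} :=
    ⟨⟨F, hF, hxF⟩⟩
  -- The directed compact sets `ψ F` shrink to the single point `hψ.toMap x`, so one of them already
  -- lies in `U`.
  obtain ⟨⟨G, hG, hxG⟩, hGU⟩ := exists_subset_nhds_of_isCompact (hψ.directed x)
    (fun F => hψ.map_compact _ F.2.1) (U := U) (by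
      intro y hy
      have hy' : y ∈ fiber ψ x := hy
      rw [hψ.fiber_eq, mem_singleton_iff] at hy'
      exact hy' ▸ hU)
  refine Filter.mem_map.2 (Filter.mem_of_superset (isOpen_interior.mem_nhds hxG) fun z hz => ?_)
  exact hGU (hψ.toMap_mem hz)

theorem closure_image_toMap (hψ : IsContactMap ψ) (F : RegClosed X) :
    closure (hψ.toMap '' F.carrier) = (ψ F).carrier := by
  have key : ∀ C : RegClosed X, closure (hψ.toMap '' C.carrier) ⊆ (ψ C).carrier := by
    intro C
    rw [← IsSkeletal.closure_image_interior hψ.continuous_toMap]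
    refine closure_minimal ?_ (isClosed _)
    rintro _ ⟨x, hx, rfl⟩
    exact hψ.toMap_mem hx
  refine (key F).antisymm ((subset_iff _ isClosed_closure).2 fun y hy => ?_)
  by_contra hyF
  obtain ⟨G, -, hyG, hG⟩ := exists_compact_nhd
    (U := interior (ψ F).carrier ∩ (closure (hψ.toMap '' F.carrier))ᶜ)
    (isOpen_interior.inter isClosed_closure.isOpen_compl) ⟨hy, hyF⟩
  -- A nonzero `C ≤ F` with `ψ C` off the image of `F` is contradictory, since the image of `C` lies
  -- both in `ψ C` and in the image of `F`.
  obtain ⟨C, hCF, rfl⟩ := hψ.lift_le F G (hG.trans (inter_subset_left.trans interior_subset))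
  have hC : C ≠ ⊥ := by
    rw [Ne, ← hψ.eq_bot_iff, ← Ne, ne_bot_iff]
    exact ⟨y, interior_subset hyG⟩
  obtain ⟨x, hx⟩ := ne_bot_iff.1 hC
  exact (hG (key C (subset_closure (mem_image_of_mem _ hx)))).2
    (subset_closure (mem_image_of_mem _ (hCF hx)))

/-- If a neighbourhood `F` maps into `closure V` but misses the preimage of `V`, then `ψ F ⊆ closure
V`. As `ψ F` has nonempty interior, that interior meets `V`, and hence so does the dense image of
`F`. -/
theorem isSkeletal_toMap (hψ : IsContactMap ψ) : IsSkeletal hψ.toMap := by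
  intro V hV x hx
  by_contra hxV
  obtain ⟨F, -, hxF, hF⟩ := exists_compact_nhd
    (U := interior (hψ.toMap ⁻¹' closure V) ∩ (closure (hψ.toMap ⁻¹' V))ᶜ)
    (isOpen_interior.inter isClosed_closure.isOpen_compl) ⟨hx, hxV⟩
  have hFV : (ψ F).carrier ⊆ closure V := by
    rw [← hψ.closure_image_toMap]
    refine closure_minimal ?_ isClosed_closure
    rintro _ ⟨z, hz, rfl⟩
    exact interior_subset (s := hψ.toMap ⁻¹' closure V) (hF hz).1
  obtain ⟨y, hy, -⟩ :=
    nonempty_inter_interior (ψ F) isOpen_univ (hψ.toMap_mem hxF) (mem_univ _)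
  obtain ⟨z, hz, hzV⟩ := mem_closure_iff.1 (hFV (interior_subset hy)) _ isOpen_interior hy
  have hz' : z ∈ closure (hψ.toMap '' F.carrier) := by
    rw [hψ.closure_image_toMap]
    exact interior_subset hz
  obtain ⟨_, hwV, w, hw, rfl⟩ := mem_closure_iff.1 hz' V hV hzV
  exact (hF hw).2 (subset_closure hwV)

end RegClosed.IsContactMap

namespace SkeLC

theorem isContactMap {X Y : SkeLC.{u}} (ψ : ESkeLC.Hom X.regClosed Y.regClosed) :
    RegClosed.IsContactMap (X := X.carrier) (Y := Y.carrier) ψ.toFun :=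
  ⟨ψ.eq_bot_iff, ψ.map_sSup, ψ.lift_le, ψ.map_contact, ψ.map_bounded⟩

instance : regClosedFunctor.{u}.Full where
  map_surjective ψ :=
    ⟨⟨(isContactMap ψ).toMap, (isContactMap ψ).continuous_toMap,
      (isContactMap ψ).isSkeletal_toMap⟩,
      ESkeLC.Hom.ext <| funext fun F => RegClosed.ext ((isContactMap ψ).closure_image_toMap F)⟩

end SkeLC

/-! ### Calculus of contact and non-tangential inclusion. -/

namespace IsContactRelation

variable {B : Type*} [BooleanAlgebra B] {ρ : B → B → Prop} {a b c d : B}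

theorem mono_right (h : IsContactRelation ρ) (hab : ρ a b) (hbc : b ≤ c) : ρ a c := by
  rw [← sup_eq_right.2 hbc]
  exact (h.sup_iff _ _ _).2 (Or.inl hab)

theorem mono (h : IsContactRelation ρ) (hab : ρ a b) (hac : a ≤ c) (hbd : b ≤ d) : ρ c d :=
  h.symm _ _ (h.mono_right (h.symm _ _ (h.mono_right hab hbd)) hac)

theorem nonTangential_mono (h : IsContactRelation ρ) (hab : NonTangential ρ a b) (hca : c ≤ a)
    (hbd : b ≤ d) : NonTangential ρ c d :=
  fun hcd => hab (h.mono hcd hca (compl_le_compl hbd))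

theorem le_of_nonTangential (h : IsContactRelation ρ) (hab : NonTangential ρ a b) : a ≤ b := by
  by_contra hle
  have hne : a ⊓ bᶜ ≠ ⊥ := fun h0 => hle (disjoint_compl_right_iff.1 (disjoint_iff.2 h0))
  exact hab (h.mono (h.refl_of_ne_bot _ hne) inf_le_left inf_le_right)

theorem nonTangential_inf (h : IsContactRelation ρ) (hab : NonTangential ρ a b)
    (hcd : NonTangential ρ c d) : NonTangential ρ (a ⊓ c) (b ⊓ d) := by
  intro hc
  rw [compl_inf, h.sup_iff] at hc
  exact hc.elim (fun hc => hab (h.mono hc inf_le_left le_rfl))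
    fun hc => hcd (h.mono hc inf_le_right le_rfl)

theorem nonTangential_compl (h : IsContactRelation ρ) (hab : NonTangential ρ a b) :
    NonTangential ρ bᶜ aᶜ := by
  rw [NonTangential, compl_compl]
  exact fun hc => hab (h.symm _ _ hc)

theorem nonTangential_top (h : IsContactRelation ρ) (a : B) : NonTangential ρ a ⊤ := by
  rw [NonTangential, compl_top]
  exact fun hc => (h.ne_bot _ _ hc).2 rfl

end IsContactRelation

/-! ### The dual space of round prime filters. -/

/-- The points of the space dual to a local contact algebra: round filters that are generated by
bounded elements and prime with respect to non-tangential inclusion. -/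
@[ext]
structure RoundFilter {B : Type*} [BooleanAlgebra B] (ρ : B → B → Prop) (I : Order.Ideal B) where
  carrier : Set B
  top_mem : ⊤ ∈ carrier
  bot_notMem : ⊥ ∉ carrier
  mem_of_le : ∀ {a b}, a ∈ carrier → a ≤ b → b ∈ carrier
  inf_mem : ∀ {a b}, a ∈ carrier → b ∈ carrier → a ⊓ b ∈ carrier
  exists_mem_bounded : ∀ {a}, a ∈ carrier → ∃ b ∈ carrier, b ∈ I ∧ NonTangential ρ b a
  compl_mem_or_mem : ∀ {a b}, a ∈ I → NonTangential ρ a b → aᶜ ∈ carrier ∨ b ∈ carrier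

namespace RoundFilter

section

variable {B : Type*} [BooleanAlgebra B] {ρ : B → B → Prop} {I : Order.Ideal B}

theorem compl_notMem (p : RoundFilter ρ I) {a : B} (ha : a ∈ p.carrier) : aᶜ ∉ p.carrier :=
  fun h => p.bot_notMem (inf_compl_self a ▸ p.inf_mem ha h)

/-- The basic open set of points containing `a`. -/
def basicOpen (ρ : B → B → Prop) (I : Order.Ideal B) (a : B) : Set (RoundFilter ρ I) :=
  {p | a ∈ p.carrier}

/-- The closed set of points not containing the complement of `a`. -/
def basicClosed (ρ : B → B → Prop) (I : Order.Ideal B) (a : B) : Set (RoundFilter ρ I) :=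
  {p | aᶜ ∉ p.carrier}

theorem basicClosed_eq (a : B) : basicClosed ρ I a = (basicOpen ρ I aᶜ)ᶜ := rfl

theorem basicOpen_mono {a b : B} (h : a ≤ b) : basicOpen ρ I a ⊆ basicOpen ρ I b :=
  fun p hp => p.mem_of_le hp h

theorem basicOpen_inf (a b : B) :
    basicOpen ρ I (a ⊓ b) = basicOpen ρ I a ∩ basicOpen ρ I b :=
  Subset.antisymm (fun p hp => ⟨p.mem_of_le hp inf_le_left, p.mem_of_le hp inf_le_right⟩)
    fun p hp => p.inf_mem hp.1 hp.2

theorem basicOpen_bot : basicOpen ρ I ⊥ = ∅ :=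
  eq_empty_of_forall_notMem fun p => p.bot_notMem

theorem basicClosed_bot : basicClosed ρ I ⊥ = ∅ :=
  eq_empty_of_forall_notMem fun p hp => hp (compl_bot (α := B) ▸ p.top_mem)

theorem basicOpen_subset_basicClosed (a : B) : basicOpen ρ I a ⊆ basicClosed ρ I a :=
  fun p => p.compl_notMem

/-- Primeness in topological form: it is how closed basic sets are fitted inside open ones. -/
theorem basicClosed_subset_basicOpen {a b : B} (ha : a ∈ I) (hab : NonTangential ρ a b) :
    basicClosed ρ I a ⊆ basicOpen ρ I b :=
  fun p hp => (p.compl_mem_or_mem ha hab).resolve_left hp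

instance : TopologicalSpace (RoundFilter ρ I) :=
  TopologicalSpace.generateFrom (range (basicOpen ρ I))

theorem isTopologicalBasis : TopologicalSpace.IsTopologicalBasis (range (basicOpen ρ I)) where
  exists_subset_inter := by
    rintro _ ⟨a, rfl⟩ _ ⟨b, rfl⟩ p hp
    exact ⟨_, ⟨a ⊓ b, rfl⟩, basicOpen_inf (ρ := ρ) (I := I) a b ▸ hp, (basicOpen_inf a b).le⟩
  sUnion_eq := sUnion_eq_univ_iff.2 fun p => ⟨_, ⟨⊤, rfl⟩, p.top_mem⟩
  eq_generateFrom := rfl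

theorem isOpen_basicOpen (a : B) : IsOpen (basicOpen ρ I a) :=
  isTopologicalBasis.isOpen ⟨a, rfl⟩

theorem isClosed_basicClosed (a : B) : IsClosed (basicClosed ρ I a) :=
  (isOpen_basicOpen aᶜ).isClosed_compl

theorem exists_basicOpen_subset {U : Set (RoundFilter ρ I)} (hU : IsOpen U)
    {p : RoundFilter ρ I} (hp : p ∈ U) : ∃ a ∈ p.carrier, basicOpen ρ I a ⊆ U := by
  obtain ⟨_, ⟨a, rfl⟩, ha, haU⟩ := isTopologicalBasis.exists_subset_of_mem_open hp hU
  exact ⟨a, ha, haU⟩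

theorem exists_basicClosed_subset {U : Set (RoundFilter ρ I)} (hU : IsOpen U)
    {p : RoundFilter ρ I} (hp : p ∈ U) : ∃ a ∈ p.carrier, a ∈ I ∧ basicClosed ρ I a ⊆ U := by
  obtain ⟨a, ha, haU⟩ := exists_basicOpen_subset hU hp
  obtain ⟨b, hb, hbI, hba⟩ := p.exists_mem_bounded ha
  exact ⟨b, hb, hbI, (basicClosed_subset_basicOpen hbI hba).trans haU⟩

/-- Roundness of `q` and primeness of `p` make the points an antichain, so distinct points can be
separated starting from either side. -/
theorem eq_of_subset {p q : RoundFilter ρ I} (hpq : p.carrier ⊆ q.carrier) : p = q := by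
  refine RoundFilter.ext (hpq.antisymm fun a ha => ?_)
  obtain ⟨b, hb, hbI, hba⟩ := q.exists_mem_bounded ha
  exact (p.compl_mem_or_mem hbI hba).resolve_left fun hbp => q.compl_notMem hb (hpq hbp)

instance : T2Space (RoundFilter ρ I) where
  t2 p q hpq := by
    obtain ⟨a, hap, haq⟩ := not_subset.1 (mt eq_of_subset hpq)
    obtain ⟨b, hbp, hbI, hba⟩ := p.exists_mem_bounded hap
    refine ⟨basicOpen ρ I b, basicOpen ρ I bᶜ, isOpen_basicOpen b, isOpen_basicOpen bᶜ, hbp,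
      (q.compl_mem_or_mem hbI hba).resolve_right haq, ?_⟩
    rw [disjoint_iff_inter_eq_empty, ← basicOpen_inf, inf_compl_self, basicOpen_bot]

/-- The round filter `{c | ∃ b ∈ I, b ∈ D ∧ b ≪ c}`, for a family `D` that behaves like an
ultrafilter up to non-tangential inclusion. -/
def generate (h : IsLocalContactAlgebra ρ I) (D : Set B) (hI : ∃ b ∈ I, b ∈ D) (hbot : ⊥ ∉ D)
    (hinf : ∀ a ∈ I, ∀ a' b, NonTangential ρ a a' → a ∈ D → b ∈ D → a' ⊓ b ∈ D)
    (hcompl : ∀ a, a ∈ D ∨ aᶜ ∈ D) : RoundFilter ρ I where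
  carrier := {c | ∃ b ∈ I, b ∈ D ∧ NonTangential ρ b c}
  top_mem := by
    obtain ⟨b, hb, hbD⟩ := hI
    exact ⟨b, hb, hbD, h.contact.nonTangential_top b⟩
  bot_notMem := by
    rintro ⟨b, -, hbD, hb⟩
    exact hbot (le_bot_iff.1 (h.contact.le_of_nonTangential hb) ▸ hbD)
  mem_of_le := by
    rintro a b ⟨c, hc, hcD, hca⟩ hab
    exact ⟨c, hc, hcD, h.contact.nonTangential_mono hca le_rfl hab⟩
  inf_mem := by
    rintro a b ⟨c, hc, hcD, hca⟩ ⟨d, hd, hdD, hdb⟩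
    -- `D` is closed under meets only after one factor is enlarged along `≪`, so `c` is replaced by
    -- an interpolant `e`.
    obtain ⟨e, he, hce, hea⟩ := h.interpolate c hc a hca
    exact ⟨e ⊓ d, I.lower inf_le_left he, hinf c hc e d hce hcD hdD,
      h.contact.nonTangential_inf hea hdb⟩
  exists_mem_bounded := by
    rintro a ⟨c, hc, hcD, hca⟩
    obtain ⟨e, he, hce, hea⟩ := h.interpolate c hc a hca
    exact ⟨e, ⟨c, hc, hcD, hce⟩, he, hea⟩
  compl_mem_or_mem := by
    intro a b ha hab
    obtain ⟨e, he, hae, heb⟩ := h.interpolate a ha b hab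
    rcases hcompl e with heD | heD
    · exact Or.inr ⟨e, he, heD, heb⟩
    · obtain ⟨c, hc, hcD⟩ := hI
      -- The element `eᶜ` may be unbounded; cutting it down by a bounded `d` with `c ≪ d` and `c ∈
      -- D` gives a bounded member of `D`.
      obtain ⟨d, hd, hcd, -⟩ := h.interpolate c hc ⊤ (h.contact.nonTangential_top c)
      exact Or.inl ⟨d ⊓ eᶜ, I.lower inf_le_left hd, hinf c hc d _ hcd hcD heD,
        h.contact.nonTangential_mono (h.contact.nonTangential_compl hae) inf_le_right le_rfl⟩

theorem basicOpen_inter_basicClosed_subset (a b : B) :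
    basicOpen ρ I a ∩ basicClosed ρ I b ⊆ basicClosed ρ I (a ⊓ b) := by
  rintro p ⟨ha, hb⟩ hab
  refine hb (p.mem_of_le (p.inf_mem ha hab) ?_)
  rw [compl_inf, inf_sup_left, inf_compl_self, bot_sup_eq]
  exact inf_le_right

theorem basicClosed_union_compl (a : B) :
    basicClosed ρ I a ∪ basicClosed ρ I aᶜ = univ := by
  refine eq_univ_of_forall fun p => or_iff_not_imp_left.2 fun ha => p.compl_notMem ?_
  exact not_not.1 ha

theorem isCompact_basicClosed (h : IsLocalContactAlgebra ρ I) {a : B} (ha : a ∈ I) :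
    IsCompact (basicClosed ρ I a) := by
  refine isCompact_iff_ultrafilter_le_nhds'.2 fun f hf => ?_
  -- The limit of the ultrafilter. Two closed basic sets may meet only along their boundaries,
  -- outside the closed set of the meet, which is why `generate` asks only for the weakened meet
  -- condition.
  let p : RoundFilter ρ I := generate h {b | basicClosed ρ I b ∈ f} ⟨a, ha, hf⟩
    (by simp [basicClosed_bot])
    (fun b hb b' c hbb' hbf hcf => Filter.mem_of_superset (Filter.inter_mem hbf hcf)
      ((inter_subset_inter_left _ (basicClosed_subset_basicOpen hb hbb')).trans
        (basicOpen_inter_basicClosed_subset b' c)))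
    (fun b => Ultrafilter.union_mem_iff.1
      (by rw [basicClosed_union_compl]; exact Filter.univ_mem))
  have hp : ↑f ≤ 𝓝 p := by
    intro U hU
    obtain ⟨V, hVU, hV, hpV⟩ := mem_nhds_iff.1 hU
    obtain ⟨c, ⟨b, hb, hbf, hbc⟩, hcV⟩ := exists_basicOpen_subset hV hpV
    exact Filter.mem_of_superset hbf
      ((basicClosed_subset_basicOpen hb hbc).trans (hcV.trans hVU))
  exact ⟨p, (isClosed_basicClosed a).mem_of_tendsto hp hf, hp⟩

theorem locallyCompactSpace (h : IsLocalContactAlgebra ρ I) :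
    LocallyCompactSpace (RoundFilter ρ I) where
  local_compact_nhds p U hU := by
    obtain ⟨V, hVU, hV, hpV⟩ := mem_nhds_iff.1 hU
    obtain ⟨a, ha, haI, haV⟩ := exists_basicClosed_subset hV hpV
    exact ⟨basicClosed ρ I a, Filter.mem_of_superset ((isOpen_basicOpen a).mem_nhds ha)
      (basicOpen_subset_basicClosed a), haV.trans hVU, isCompact_basicClosed h haI⟩

theorem inter_nonempty_of_contact (h : IsLocalContactAlgebra ρ I) {a b : B} (hab : ρ a b) :
    (basicClosed ρ I a ∩ basicClosed ρ I b).Nonempty := by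
  -- Truncating `b` by a bounded `c` provides the bounded member that `generate` needs.
  obtain ⟨c, hc, hac⟩ := h.contact_bounded a b hab
  let J : Order.Ideal B :=
    { carrier := {d | ¬ ρ a d}
      lower' := fun d e hed hd he => hd (h.contact.mono_right he hed)
      nonempty' := ⟨⊥, fun hb => (h.contact.ne_bot _ _ hb).2 rfl⟩
      directed' := fun d hd e he => ⟨d ⊔ e, fun hde =>
        ((h.contact.sup_iff _ _ _).1 hde).elim hd he, le_sup_left, le_sup_right⟩ }
  have hJ : Disjoint (Order.PFilter.principal (c ⊓ b) : Set B) J :=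
    Set.disjoint_left.2 fun d hd hdJ => hdJ (h.contact.mono_right hac hd)
  -- The complement of `P` is an ultrafilter containing `c ⊓ b`, all of whose members are in contact
  -- with `a`.
  obtain ⟨P, hP, hJP, hPd⟩ := DistribLattice.prime_ideal_of_disjoint_filter_ideal hJ
  have hcP : c ⊓ b ∉ P := Set.disjoint_left.1 hPd (show c ⊓ b ≤ c ⊓ b from le_rfl)
  let p : RoundFilter ρ I := generate h {d | d ∉ P} ⟨c ⊓ b, I.lower inf_le_left hc, hcP⟩
    (not_not.2 P.bot_mem)
    (fun d hd d' e hdd' hdP heP hP' => (hP.mem_or_mem (P.lower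
      (inf_le_inf_right e (h.contact.le_of_nonTangential hdd')) hP')).elim hdP heP)
    (fun d => by
      by_contra! hd
      obtain ⟨h1, h2⟩ := hd
      refine hcP (P.lower (le_top.trans_eq sup_compl_eq_top.symm)
        (Order.Ideal.sup_mem (not_not.1 h1) (not_not.1 h2))))
  refine ⟨p, ?_, ?_⟩
  · rintro ⟨d, -, hdP, hda⟩
    rw [NonTangential, compl_compl] at hda
    exact hdP (hJP fun had => hda (h.contact.symm _ _ had))
  · rintro ⟨d, -, hdP, hdb⟩
    refine (hP.mem_or_mem (x := d) (y := c ⊓ b) ?_).elim hdP hcP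
    have : d ⊓ (c ⊓ b) ≤ ⊥ := by
      rw [← compl_inf_eq_bot (a := b)]
      exact inf_le_inf (h.contact.le_of_nonTangential hdb) inf_le_right
    exact P.lower this P.bot_mem

theorem basicOpen_nonempty (h : IsLocalContactAlgebra ρ I) {a : B} (ha : a ≠ ⊥) :
    (basicOpen ρ I a).Nonempty := by
  obtain ⟨b, hb, hb0, hba⟩ := h.exists_bounded a ha
  obtain ⟨p, hp, -⟩ := inter_nonempty_of_contact h (h.contact.refl_of_ne_bot b hb0)
  exact ⟨p, basicClosed_subset_basicOpen hb hba hp⟩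

theorem contact_iff (h : IsLocalContactAlgebra ρ I) {a b : B} :
    ρ a b ↔ (basicClosed ρ I a ∩ basicClosed ρ I b).Nonempty := by
  refine ⟨inter_nonempty_of_contact h, fun ⟨p, ha, hb⟩ => ?_⟩
  by_contra hab
  obtain ⟨c, hc, hcI, -⟩ := p.exists_mem_bounded p.top_mem
  -- Primeness applies only to bounded elements, so `a` is first cut down by a bounded `c` from `p`.
  have hcab : NonTangential ρ (c ⊓ a) bᶜ := by
    rw [NonTangential, compl_compl]
    exact fun hcab => hab (h.contact.mono hcab inf_le_right le_rfl)
  exact (p.compl_mem_or_mem (I.lower inf_le_left hcI) hcab).elim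
    (basicOpen_inter_basicClosed_subset c a ⟨hc, ha⟩) hb

theorem basicOpen_subset_iff (h : IsLocalContactAlgebra ρ I) {a b : B} :
    basicOpen ρ I a ⊆ basicOpen ρ I b ↔ a ≤ b := by
  refine ⟨fun hab => ?_, basicOpen_mono⟩
  by_contra hle
  obtain ⟨p, hp⟩ := basicOpen_nonempty h
    (fun h0 => hle (disjoint_compl_right_iff.1 (disjoint_iff.2 h0)) : a ⊓ bᶜ ≠ ⊥)
  rw [basicOpen_inf] at hp
  exact p.compl_notMem (hab hp.1) hp.2

theorem basicClosed_subset_iff (h : IsLocalContactAlgebra ρ I) {a b : B} :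
    basicClosed ρ I a ⊆ basicClosed ρ I b ↔ a ≤ b := by
  rw [basicClosed_eq, basicClosed_eq, compl_subset_compl, basicOpen_subset_iff h,
    compl_le_compl_iff_le]

theorem closure_basicOpen (h : IsLocalContactAlgebra ρ I) (a : B) :
    closure (basicOpen ρ I a) = basicClosed ρ I a := by
  refine (closure_minimal (basicOpen_subset_basicClosed a) (isClosed_basicClosed a)).antisymm
    fun p hp => mem_closure_iff.2 fun U hU hpU => ?_
  obtain ⟨c, hc, hcU⟩ := exists_basicOpen_subset hU hpU
  have hca : c ⊓ a ≠ ⊥ := fun h0 =>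
    hp (p.mem_of_le hc (le_compl_iff_disjoint_right.2 (disjoint_iff.2 h0)))
  obtain ⟨q, hq⟩ := basicOpen_nonempty h hca
  rw [basicOpen_inf] at hq
  exact ⟨q, hcU hq.1, hq.2⟩

theorem interior_basicClosed (h : IsLocalContactAlgebra ρ I) (a : B) :
    interior (basicClosed ρ I a) = basicOpen ρ I a := by
  rw [basicClosed_eq, interior_compl, closure_basicOpen h, basicClosed_eq, compl_compl,
    compl_compl]

/-- The regular closed set of points not containing the complement of `a`. -/
def toRegClosed (h : IsLocalContactAlgebra ρ I) (a : B) : RegClosed (RoundFilter ρ I) :=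
  ⟨basicClosed ρ I a, by rw [interior_basicClosed h, closure_basicOpen h]⟩

theorem isCompact_basicClosed_iff (h : IsLocalContactAlgebra ρ I) {a : B} :
    IsCompact (basicClosed ρ I a) ↔ a ∈ I := by
  refine ⟨fun ha => ?_, isCompact_basicClosed h⟩
  have : Nonempty I := I.nonempty.to_subtype
  -- The open sets of bounded elements form a directed cover of the space, so a compact set lies in
  -- a single one of them.
  have hdir : Directed (· ⊆ ·) fun c : I => basicOpen ρ I (c : B) := fun c d =>
    ⟨⟨c ⊔ d, Order.Ideal.sup_mem c.2 d.2⟩, basicOpen_mono le_sup_left,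
      basicOpen_mono le_sup_right⟩
  obtain ⟨c, hc⟩ := ha.elim_directed_cover (fun c : I => basicOpen ρ I (c : B))
    (fun c => isOpen_basicOpen _) (fun p _ => by
      obtain ⟨c, hc, hcI, -⟩ := p.exists_mem_bounded p.top_mem
      exact mem_iUnion.2 ⟨⟨c, hcI⟩, hc⟩) hdir
  exact I.lower ((basicClosed_subset_iff h).1 (hc.trans (basicOpen_subset_basicClosed _))) c.2

end

/-! ### Representation of complete algebras and essential surjectivity. -/

theorem toRegClosed_surjective {B : Type*} [CompleteBooleanAlgebra B] {ρ : B → B → Prop}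
    {I : Order.Ideal B} (h : IsLocalContactAlgebra ρ I) :
    Function.Surjective (toRegClosed h) := by
  intro F
  set U := interior F.carrier with hU
  -- Completeness enters here. The join adds nothing beyond `closure U`: an element `d ≤ a` whose
  -- open set misses `U` is disjoint from every joinand, hence from `a`.
  set a := sSup {b | basicOpen ρ I b ⊆ U} with ha
  have hUa : U ⊆ basicOpen ρ I a := fun p hp => by
    obtain ⟨b, hb, hbU⟩ := exists_basicOpen_subset isOpen_interior hp
    exact p.mem_of_le hb (le_sSup hbU)
  have haU : basicOpen ρ I a ⊆ closure U := by
    intro p hp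
    by_contra hpU
    obtain ⟨d, hd, hdU⟩ := exists_basicOpen_subset
      (U := basicOpen ρ I a ∩ (closure U)ᶜ)
      ((isOpen_basicOpen a).inter isClosed_closure.isOpen_compl) ⟨hp, hpU⟩
    have hda : d ≤ a := (basicOpen_subset_iff h).1 (hdU.trans inter_subset_left)
    have had : a ≤ dᶜ := sSup_le fun b hb => by
      refine le_compl_iff_disjoint_right.2 (disjoint_iff.2 ?_)
      by_contra hbd
      obtain ⟨q, hq⟩ := basicOpen_nonempty h hbd
      rw [basicOpen_inf] at hq
      exact (hdU hq.2).2 (subset_closure (hb hq.1))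
    exact p.compl_notMem hd (p.mem_of_le hd (hda.trans had))
  refine ⟨a, RegClosed.ext ?_⟩
  change basicClosed ρ I a = F.carrier
  rw [← closure_basicOpen h, ← F.closure_interior]
  exact (closure_minimal haU isClosed_closure).antisymm (closure_mono hUa)

/-- A complete local contact algebra is order isomorphic to the algebra of regular closed subsets
of its dual space. -/
noncomputable def orderIso {B : Type*} [CompleteBooleanAlgebra B] {ρ : B → B → Prop}
    {I : Order.Ideal B} (h : IsLocalContactAlgebra ρ I) : B ≃o RegClosed (RoundFilter ρ I) :=
  RelIso.ofSurjective
    (OrderEmbedding.ofMapLEIff (toRegClosed h) fun _ _ => basicClosed_subset_iff h)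
    (toRegClosed_surjective h)

end RoundFilter

namespace ESkeLC

variable {A B : ESkeLC.{u}}

/-- An order isomorphism preserving contact and boundedness is a morphism. -/
def Hom.ofOrderIso (e : A.carrier ≃o B.carrier)
    (hc : ∀ a b, A.contact a b → B.contact (e a) (e b))
    (hb : ∀ a ∈ A.bounded, e a ∈ B.bounded) : ESkeLC.Hom A B where
  toFun := e
  eq_bot_iff _ := map_eq_bot_iff e
  map_sSup S := by rw [e.map_sSup, sSup_image]
  lift_le a b h := ⟨e.symm b, by rwa [e.symm_apply_le], e.apply_symm_apply b⟩
  map_contact := hc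
  map_bounded := hb

/-- An order isomorphism preserving and reflecting contact and boundedness is an isomorphism. -/
def isoOfOrderIso (e : A.carrier ≃o B.carrier)
    (hc : ∀ a b, A.contact a b ↔ B.contact (e a) (e b))
    (hb : ∀ a, a ∈ A.bounded ↔ e a ∈ B.bounded) : A ≅ B where
  hom := Hom.ofOrderIso e (fun a b => (hc a b).1) fun a => (hb a).1
  inv := Hom.ofOrderIso e.symm (fun a b h => (hc _ _).2 (by simpa using h))
    fun a h => (hb _).2 (by simpa using h)
  hom_inv_id := ESkeLC.Hom.ext (funext e.symm_apply_apply)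
  inv_hom_id := ESkeLC.Hom.ext (funext e.apply_symm_apply)

/-- The locally compact Hausdorff space dual to a complete local contact algebra. -/
def dualSpace (A : ESkeLC.{u}) : SkeLC.{u} :=
  haveI := RoundFilter.locallyCompactSpace A.isLCA
  ⟨RoundFilter A.contact A.bounded⟩

end ESkeLC

instance : SkeLC.regClosedFunctor.{u}.EssSurj where
  mem_essImage A := ⟨A.dualSpace, ⟨Iso.symm <|
    ESkeLC.isoOfOrderIso (B := A.dualSpace.regClosed) (RoundFilter.orderIso A.isLCA)
      (fun _ _ => RoundFilter.contact_iff A.isLCA)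
      fun _ => (RoundFilter.isCompact_basicClosed_iff A.isLCA).symm⟩⟩

theorem theorem4p3 : Nonempty (SkeLC.{u} ≌ ESkeLC.{u}) :=
  haveI : SkeLC.regClosedFunctor.{u}.IsEquivalence := { }
  ⟨SkeLC.regClosedFunctor.asEquivalence⟩
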